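/- Let \(n>0\) and let \(W\) be a standard Brownian motion on \([-\tfrac12,\tfrac12]\) (started at \(-\tfrac12\)). For a function \(f\) consider the white noise observation \[ dY(t)=f(t)\,dt+n^{-1/2}\,dW(t),\qquad Y(-\tfrac12)=0,\qquad -\tfrac12\le t\le \tfrac12 , \] and write \(P_f, E_f\) for probability and expectation under \(f\). Let \(F_c\) be the class of all convex functions \([-\tfrac12,\tfrac12]\to\mathbb R\). A confidence interval \(\mathrm{CI}\) is a (measurable) random interval, possibly empty or unbounded, that is a function of the path \(Y\); \(L(\mathrm{CI})\) is its length. For \(f\in F_c\) put \[ L^*_\alpha(f,F_c)=\inf\bigl\{E_f L(\mathrm{CI}) : P_g\bigl(g(0)\in \mathrm{CI}\bigr)\ge 1-\alpha \text{ for all } g\in F_c\bigr\}. \] Let \(z_\alpha=\Phi^{-1}(1-\alpha)\), where \(\Phi\) is the standard normal distribution function, and for integers \(j\ge1\) let \[ \sigma_j=\sqrt{2^{j-1}/n},\qquad \delta_j=2^{j-1}\bigl(Y(2^{-j})-Y(-2^{-j})\bigr),\qquad T_j=\delta_j-\delta_{j+1}. \] Let \(0<\alpha\le 0.2\) and \(f\in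 F_c\). Then there is a \(j\ge 1\) with \(E_fT_j\le\tfrac23 z_\alpha\sigma_j\), and, with \(j_*^c=\min\{j\ge1: E_fT_j\le\tfrac23 z_\alpha\sigma_j\}\), \[ L^*_\alpha(f,F_c)\;\ge\;\Bigl(1-\frac{1}{\sqrt{2\pi}\,z_\alpha}\Bigr)\frac{\sqrt2}{3}\,z_\alpha\,\sigma_{j_*^c}. \] -/

import Mathlib

open MeasureTheory ProbabilityTheory Set
open scoped NNReal ENNReal

noncomputable section

namespace WhiteNoise

/-- The observation interval `[-1/2, 1/2]`. -/
abbrev obsInterval : Set ℝ := Icc (-(1 / 2)) (1 / 2)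

/-- The space of sample paths on `[-1/2, 1/2]`. It carries the product sigma-algebra, that is,
the sigma-algebra generated by the evaluations `y ↦ y t`. -/
abbrev Path : Type := obsInterval → ℝ

/-- The white noise observation `Y(t) = ∫_{-1/2}^t f(s) ds + n^{-1/2} W(t)`, where the Brownian
motion `W` on `[-1/2, 1/2]` starts at the left endpoint: `W(t) = B(t + 1/2)` with `B` a standard
Brownian motion on `[0, ∞)`. Only `t ∈ [-1/2, 1/2]` is meaningful. -/
def obs {Ω : Type*} (B : ℝ≥0 → Ω → ℝ) (n : ℝ) (f : ℝ → ℝ) (t : ℝ) (ω : Ω) : ℝ :=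
  (∫ s in (-(1 / 2) : ℝ)..t, f s) + (√n)⁻¹ * B (t + 1 / 2).toNNReal ω

/-- The observed sample path of the white noise model on `[-1/2, 1/2]`. -/
def obsPath {Ω : Type*} (B : ℝ≥0 → Ω → ℝ) (n : ℝ) (f : ℝ → ℝ) (ω : Ω) : Path :=
  fun t => obs B n f t ω

/-- A confidence interval based on the observed path: to each path it assigns an interval of the
real line (possibly empty or unbounded, with or without its endpoints), measurably in the sense
that `{(y, x) | x ∈ CI y}` is a measurable set. -/
structure ConfInterval where
  /-- The interval reported for a given path. -/
  toSet : Path → Set ℝ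
  /-- The reported set is an interval. -/
  ordConnected : ∀ y, (toSet y).OrdConnected
  /-- Measurability of the random interval. -/
  measurableSet_graph : MeasurableSet {p : Path × ℝ | p.2 ∈ toSet p.1}

/-- Length of an interval: its Lebesgue measure (`0` if empty, `∞` if unbounded). -/
def ConfInterval.length (C : ConfInterval) (y : Path) : ℝ≥0∞ := volume (C.toSet y)

/-- The expected length `L(CI, f) = E_f (L(CI))`. -/
def expectedLength {Ω : Type*} [MeasurableSpace Ω] (P : Measure Ω) (B : ℝ≥0 → Ω → ℝ) (n : ℝ)
    (f : ℝ → ℝ) (C : ConfInterval) : ℝ≥0∞ :=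
  ∫⁻ ω, C.length (obsPath B n f ω) ∂P

/-- The collection of all confidence intervals which cover `g(0)` with probability at least
`1 - α` under each `g` in the class `F`. -/
def coveringIntervals {Ω : Type*} [MeasurableSpace Ω] (P : Measure Ω) (B : ℝ≥0 → Ω → ℝ) (n : ℝ)
    (α : ℝ) (F : Set (ℝ → ℝ)) : Set ConfInterval :=
  {C | ∀ g ∈ F, ENNReal.ofReal (1 - α) ≤ P {ω | g 0 ∈ C.toSet (obsPath B n g ω)}}

/-- The benchmark `L*_α(f, F)`: the infimum of the expected length at `f` over all confidence
intervals with guaranteed coverage `1 - α` over `F`. -/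
def benchmark {Ω : Type*} [MeasurableSpace Ω] (P : Measure Ω) (B : ℝ≥0 → Ω → ℝ) (n : ℝ)
    (α : ℝ) (f : ℝ → ℝ) (F : Set (ℝ → ℝ)) : ℝ≥0∞ :=
  ⨅ C ∈ coveringIntervals P B n α F, expectedLength P B n f C

/-- The class `F_c` of convex functions on `[-1/2, 1/2]`; values outside the interval are never
used. -/
def convexClass : Set (ℝ → ℝ) := {f | ConvexOn ℝ obsInterval f}

/-- The upper normal quantile `z_α = Φ⁻¹(1 - α)`. -/
def zQuantile (α : ℝ) : ℝ := sInf {x : ℝ | 1 - α ≤ cdf (gaussianReal 0 1) x}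

/-- `σ_j = √(2^{j-1} / n)`. -/
def sigma (n : ℝ) (j : ℕ) : ℝ := √((2 : ℝ) ^ ((j : ℤ) - 1) / n)

/-- The estimator `δ_j = 2^{j-1} (Y(2^{-j}) - Y(-2^{-j}))`. -/
def delta {Ω : Type*} (B : ℝ≥0 → Ω → ℝ) (n : ℝ) (f : ℝ → ℝ) (j : ℕ) (ω : Ω) : ℝ :=
  (2 : ℝ) ^ ((j : ℤ) - 1) *
    (obs B n f ((2 : ℝ) ^ (-(j : ℤ))) ω - obs B n f (-(2 : ℝ) ^ (-(j : ℤ))) ω)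

/-- The statistic `T_j = δ_j - δ_{j+1}`. -/
def tStat {Ω : Type*} (B : ℝ≥0 → Ω → ℝ) (n : ℝ) (f : ℝ → ℝ) (j : ℕ) (ω : Ω) : ℝ :=
  delta B n f j ω - delta B n f (j + 1) ω

/-- The set of scales `j ≥ 1` with `E_f T_j ≤ (2/3) z_α σ_j`. -/
def scaleSet {Ω : Type*} [MeasurableSpace Ω] (P : Measure Ω) (B : ℝ≥0 → Ω → ℝ) (n : ℝ)
    (α : ℝ) (f : ℝ → ℝ) : Set ℕ :=
  {j | 1 ≤ j ∧ ∫ ω, tStat B n f j ω ∂P ≤ 2 / 3 * zQuantile α * sigma n j}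

/-- The index `j_*^c`, the smallest `j ≥ 1` with `E_f T_j ≤ (2/3) z_α σ_j`. -/
def jStar {Ω : Type*} [MeasurableSpace Ω] (P : Measure Ω) (B : ℝ≥0 → Ω → ℝ) (n : ℝ)
    (α : ℝ) (f : ℝ → ℝ) : ℕ :=
  sInf (scaleSet P B n α f)

end WhiteNoise

end

open WhiteNoise

namespace WhiteNoise

/-! Write z for z_α and h for (√2/3) z σ_j at j = j_*^c. Suppose the segment f + λD, 0 ≤ λ ≤ 1,
stays in the class, D(0) = h and n‖D‖² ≤ z². A valid interval covers x = f(0) + λh with probability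
at least 1 - α = Φ(z) under f + λD. That function and f are at normal testing distance at most λz,
so by Neyman–Pearson x is still covered under f with probability at least Φ(z - λz). By Tonelli the
expected length at f is at least (h/z) ∫₀^z Φ ≥ (h/z)(z - E max(Z, 0)) = h(1 - 1/(√(2π) z)), where Z
is standard normal (`le_benchmark_of_segment`).

The direction D comes from minimality of j. If j = 1, a constant will do. If j = k + 1, scale k
fails, so E T_k > (2/3) z σ_k = h. By convexity E T_k is at most d, the height above f(0) of the
chord of f over [-u, u] with u = 2^{-k}. Raising f a fraction h/d of the way to that chord keeps it
convex and lifts it by h at 0; `integral_sq_max_chord_le` bounds the squared norm of the lift by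
4uh², and n · 4uh² = (8/9) z².

The testing bound for path events is obtained without a Girsanov density: on cylinder events a drift
is a translation along one Gaussian variable, and general events are approximated by cylinders. -/

/-! ### Neyman–Pearson for a normal shift -/

/-- Translating a standard normal variable amounts to an exponential change of measure. -/
lemma integral_gaussianReal_comp_add (ψ : ℝ → ℝ) (d : ℝ) :
    ∫ x, ψ (x + d) ∂(gaussianReal 0 1) =
      ∫ x, ψ x * Real.exp (d * x - d ^ 2 / 2) ∂(gaussianReal 0 1) := by
  rw [integral_gaussianReal_eq_integral_smul one_ne_zero,
    integral_gaussianReal_eq_integral_smul one_ne_zero,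
    ← integral_add_right_eq_self (μ := volume)
      (fun y ↦ gaussianPDFReal 0 1 y • (ψ y * Real.exp (d * y - d ^ 2 / 2))) d]
  refine integral_congr_ae (Filter.Eventually.of_forall fun x ↦ ?_)
  simp only [gaussianPDFReal, smul_eq_mul, NNReal.coe_one, mul_one, sub_zero]
  rw [mul_comm (ψ (x + d)), ← mul_assoc, mul_assoc _ (Real.exp _) (Real.exp _), ← Real.exp_add]
  ring_nf

lemma gaussianReal_real_Ici (c : ℝ) :
    (gaussianReal 0 1).real (Ici c) = cdf (gaussianReal 0 1) (-c) := by
  have h := gaussianReal_map_neg (μ := 0) (v := 1)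
  rw [neg_zero] at h
  rw [cdf_eq_real]
  nth_rewrite 1 [← h]
  rw [map_measureReal_apply measurable_neg measurableSet_Ici]
  congr 1
  ext x
  simp

/-- A quantitative form of the Neyman--Pearson lemma for testing between `N(0, 1)` and
`N(d, 1)` by means of a randomised test `ψ`. -/
lemma cdf_sub_le_of_test {ψ : ℝ → ℝ} (hψ : Measurable ψ) (h0 : ∀ x, 0 ≤ ψ x) (h1 : ∀ x, ψ x ≤ 1)
    (z : ℝ) {d : ℝ} (hd : 0 ≤ d) :
    cdf (gaussianReal 0 1) (z - d) ≤ ∫ x, ψ x ∂(gaussianReal 0 1) +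
      Real.exp (z ^ 2 / 2) *
        max 0 (cdf (gaussianReal 0 1) z - ∫ x, ψ (x + d) ∂(gaussianReal 0 1)) := by
  set γ := gaussianReal 0 1
  -- The likelihood ratio exp(dx - d²/2) crosses `ℓ` exactly at x = d - z, so `χ` is the optimal
  -- test, with power Φ(z) and size Φ(z - d).
  set χ : ℝ → ℝ := (Ici (d - z)).indicator 1
  set ℓ : ℝ := Real.exp (d ^ 2 / 2 - d * z)
  have hχm : Measurable χ := measurable_one.indicator measurableSet_Ici
  have hχ : ∫ x, χ x ∂γ = cdf γ (z - d) := by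
    rw [integral_indicator_one measurableSet_Ici, gaussianReal_real_Ici, neg_sub]
  have hχd : ∫ x, χ (x + d) ∂γ = cdf γ z := by
    have : (fun x ↦ χ (x + d)) = (Ici (-z)).indicator 1 := by
      ext x
      simp only [χ, indicator, mem_Ici]
      congr 1
      rw [eq_iff_iff]
      constructor <;> intro h <;> linarith
    rw [this, integral_indicator_one measurableSet_Ici, gaussianReal_real_Ici, neg_neg]
  have hb : ∀ x, ‖ψ x‖ ≤ 1 := fun x ↦ by rw [Real.norm_of_nonneg (h0 x)]; exact h1 x
  have hbχ : ∀ x, ‖χ x‖ ≤ 1 := fun x ↦ by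
    simp only [χ, indicator]; split_ifs <;> simp
  have hL : Integrable (fun x ↦ Real.exp (d * x - d ^ 2 / 2)) γ := by
    simp_rw [sub_eq_add_neg, Real.exp_add]
    exact (integrable_exp_mul_gaussianReal d).mul_const _
  have iψ : Integrable ψ γ := .of_bound hψ.aestronglyMeasurable 1 (.of_forall hb)
  have iχ : Integrable χ γ := .of_bound hχm.aestronglyMeasurable 1 (.of_forall hbχ)
  have iψL := hL.bdd_mul hψ.aestronglyMeasurable (.of_forall hb)
  have iχL := hL.bdd_mul hχm.aestronglyMeasurable (.of_forall hbχ)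
  have key : ∫ x, ψ (x + d) ∂γ - cdf γ z ≤ ℓ * (∫ x, ψ x ∂γ - cdf γ (z - d)) := by
    rw [← hχ, ← hχd, integral_gaussianReal_comp_add, integral_gaussianReal_comp_add,
      ← integral_sub iψL iχL, ← integral_sub iψ iχ, ← integral_const_mul]
    refine integral_mono (iψL.sub iχL) ((iψ.sub iχ).const_mul _) fun x ↦ ?_
    have hx : (ψ x - χ x) * (Real.exp (d * x - d ^ 2 / 2) - ℓ) ≤ 0 := by
      by_cases hc : d - z ≤ x
      · have e1 : χ x = 1 := by simp [χ, hc]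
        have e2 : ℓ ≤ Real.exp (d * x - d ^ 2 / 2) := Real.exp_le_exp.2 (by nlinarith)
        exact mul_nonpos_of_nonpos_of_nonneg (by linarith [h1 x]) (by linarith)
      · have e1 : χ x = 0 := by simp [χ, hc]
        have e2 : Real.exp (d * x - d ^ 2 / 2) ≤ ℓ := Real.exp_le_exp.2 (by nlinarith)
        exact mul_nonpos_of_nonneg_of_nonpos (by linarith [h0 x]) (by linarith)
    dsimp only
    nlinarith
  -- 1/ℓ = exp(dz - d²/2) is at most exp(z²/2), a constant free of d. The power deficit is kept in
  -- the bound so that it survives approximation of the event.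
  have hℓ : ℓ * Real.exp (z ^ 2 / 2) ≥ 1 := by
    rw [← Real.exp_add]
    exact Real.one_le_exp (by nlinarith [sq_nonneg (z - d)])
  have hℓ0 : 0 < ℓ := Real.exp_pos _
  set m := max 0 (cdf γ z - ∫ x, ψ (x + d) ∂γ)
  have hm : cdf γ z - ∫ x, ψ (x + d) ∂γ ≤ m := le_max_right _ _
  have hm0 : 0 ≤ m := le_max_left _ _
  refine le_of_mul_le_mul_left ?_ hℓ0
  nlinarith [mul_le_mul_of_nonneg_right hℓ hm0]

/-! ### The normal distribution function and its quantile -/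

lemma continuous_cdf_gaussianReal : Continuous (cdf (gaussianReal 0 1)) := by
  have := nullSingletonClass_gaussianReal (μ := 0) (v := 1) one_ne_zero
  rw [continuous_iff_continuousAt]
  intro x
  rw [(monotone_cdf _).continuousAt_iff_leftLim_eq_rightLim, StieltjesFunction.rightLim_eq]
  have h := StieltjesFunction.measure_singleton (cdf (gaussianReal 0 1)) x
  rw [measure_cdf, measure_singleton, eq_comm, ENNReal.ofReal_eq_zero] at h
  exact le_antisymm ((monotone_cdf _).leftLim_le le_rfl) (by linarith)

lemma cdf_gaussianReal_zero : cdf (gaussianReal 0 1) 0 = 1 / 2 := by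
  have := nullSingletonClass_gaussianReal (μ := 0) (v := 1) one_ne_zero
  have h := gaussianReal_real_Ici 0
  have h2 := cdf_eq_real (gaussianReal 0 1) 0
  have h3 := measureReal_compl (μ := gaussianReal 0 1) (measurableSet_Iic (a := (0 : ℝ)))
  rw [compl_Iic, ← measureReal_congr Ioi_ae_eq_Ici.symm] at h3
  rw [neg_zero] at h
  simp at h3
  linarith

lemma cdf_zQuantile {α : ℝ} (h0 : 0 < α) (h1 : α < 1) :
    cdf (gaussianReal 0 1) (zQuantile α) = 1 - α := by
  obtain ⟨x, hx⟩ : ∃ x, cdf (gaussianReal 0 1) x = 1 - α :=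
    mem_range_of_exists_le_of_exists_ge continuous_cdf_gaussianReal
      (((tendsto_cdf_atBot _).eventually_le_const (by linarith)).exists)
      (((tendsto_cdf_atTop _).eventually_const_le (by linarith)).exists)
  have hb : BddBelow {x : ℝ | 1 - α ≤ cdf (gaussianReal 0 1) x} := by
    obtain ⟨y, hy⟩ := ((tendsto_cdf_atBot (gaussianReal 0 1)).eventually_lt_const
      (show (0 : ℝ) < 1 - α by linarith)).exists
    refine ⟨y, fun w hw ↦ ?_⟩
    by_contra hlt
    have h1 := monotone_cdf (gaussianReal 0 1) (not_le.1 hlt).le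
    rw [mem_ofPred_eq] at hw
    linarith
  have hcl : IsClosed {x : ℝ | 1 - α ≤ cdf (gaussianReal 0 1) x} :=
    isClosed_le continuous_const continuous_cdf_gaussianReal
  refine le_antisymm ?_ (hcl.csInf_mem ⟨x, hx.ge⟩ hb)
  rw [← hx]
  exact monotone_cdf _ (csInf_le hb hx.ge)

lemma zQuantile_pos {α : ℝ} (h0 : 0 < α) (h1 : α < 1 / 2) : 0 < zQuantile α := by
  by_contra h
  have h2 := monotone_cdf (gaussianReal 0 1) (not_lt.1 h)
  rw [cdf_zQuantile h0 (by linarith), cdf_gaussianReal_zero] at h2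
  linarith

/-- The mean of the positive part of a standard normal variable. -/
lemma integral_max_zero_gaussianReal :
    ∫ x, max x 0 ∂(gaussianReal 0 1) = 1 / √(2 * Real.pi) := by
  rw [integral_gaussianReal_eq_integral_smul one_ne_zero]
  have h1 : (fun x : ℝ ↦ gaussianPDFReal 0 1 x • max x 0) =
      (Ioi 0).indicator fun x ↦ (√(2 * Real.pi))⁻¹ * (x * Real.exp (-x ^ 2 / 2)) := by
    ext x
    by_cases hx : 0 < x
    · simp [indicator, hx, gaussianPDFReal, hx.le]
      ring
    · simp [indicator, hx, not_lt.1 hx]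
  rw [h1, integral_indicator measurableSet_Ioi, integral_const_mul]
  have hd : ∀ x ∈ Ici (0 : ℝ), HasDerivAt (fun x ↦ -Real.exp (-x ^ 2 / 2))
      (x * Real.exp (-x ^ 2 / 2)) x := fun x _ ↦ by
    refine ((((hasDerivAt_pow 2 x).neg.div_const 2).exp).neg).congr_deriv ?_
    simp
    ring
  have ht : Filter.Tendsto (fun x : ℝ ↦ -Real.exp (-x ^ 2 / 2)) Filter.atTop (nhds 0) := by
    rw [← neg_zero]
    refine (Real.tendsto_exp_atBot.comp ?_).neg
    have h := (Filter.tendsto_pow_atTop (α := ℝ) two_ne_zero).atTop_div_const (r := 2) (by norm_num)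
    convert Filter.tendsto_neg_atTop_atBot.comp h using 2
    simp [neg_div]
  rw [integral_Ioi_of_hasDerivAt_of_nonneg' hd
    (fun x hx ↦ mul_nonneg (le_of_lt hx) (Real.exp_pos _).le) ht]
  simp

/-- Integrating the normal distribution function over `[0, z]`. -/
lemma le_integral_cdf {z : ℝ} (hz : 0 ≤ z) :
    z - 1 / √(2 * Real.pi) ≤ ∫ s in (0 : ℝ)..z, cdf (gaussianReal 0 1) s := by
  set γ := gaussianReal 0 1
  have hi : Integrable (fun x : ℝ ↦ max x 0) γ := by
    have : Integrable (fun x : ℝ ↦ x) γ := by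
      exact (memLp_id_gaussianReal (μ := 0) (v := 1) 1).integrable (by simp)
    exact this.pos_part
  -- Layer cake: E max(Z, 0) is the integral of P(Z > s) = 1 - Φ(s) over s > 0, so the part over (0,
  -- z] is at most 1/√(2π).
  have hL := lintegral_eq_lintegral_meas_lt γ (f := fun x ↦ max x 0)
    (.of_forall fun x ↦ le_max_right _ _) (by fun_prop)
  rw [← ofReal_integral_eq_lintegral_ofReal hi (.of_forall fun x ↦ le_max_right _ _),
    integral_max_zero_gaussianReal] at hL
  have hc : Continuous fun s ↦ 1 - cdf γ s := continuous_const.sub continuous_cdf_gaussianReal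
  have h3 : ∫ s in (0 : ℝ)..z, (1 - cdf γ s) ≤ 1 / √(2 * Real.pi) := by
    rw [← ENNReal.ofReal_le_ofReal_iff (by positivity), hL,
      intervalIntegral.integral_of_le hz, ofReal_integral_eq_lintegral_ofReal
        (hc.integrableOn_Ioc) (.of_forall fun s ↦ by simpa using cdf_le_one γ s)]
    refine (lintegral_mono_set Ioc_subset_Ioi_self).trans
      (setLIntegral_mono' measurableSet_Ioi fun s hs ↦ ?_)
    have : {a : ℝ | s < max a 0} = (Iic s)ᶜ := by
      ext a
      simp [not_lt.2 (le_of_lt (mem_Ioi.1 hs))]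
    rw [this, prob_compl_eq_one_sub measurableSet_Iic, ← ofReal_cdf, ENNReal.ofReal_sub _
      (cdf_nonneg _ _), ENNReal.ofReal_one]
  rw [intervalIntegral.integral_sub (by simp) (continuous_cdf_gaussianReal.intervalIntegrable _ _)]
    at h3
  simp at h3
  simp
  linarith

/-! ### Gaussian shifts along one variable -/

/-- Testing a centred Gaussian shift: if `ξ` is jointly Gaussian with the process `X`, then
translating `X` by `t ↦ cov(ξ, X t)` cannot be detected better than translating a standard normal
variable by the standard deviation of `ξ`. -/
lemma cdf_sub_le_of_gaussian_shift {Ω T : Type*} [MeasurableSpace Ω] {P : Measure Ω}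
    {X : T → Ω → ℝ} {ξ : Ω → ℝ} (hG : IsGaussianProcess (Sum.elim X fun _ : Unit ↦ ξ) P)
    (hX : ∀ t, Measurable (X t)) (hξ : Measurable ξ) (hmean : P[ξ] = 0)
    {d : ℝ} (hd : 0 ≤ d) (hvar : Var[ξ; P] = d ^ 2) {m : T → ℝ} (hm : ∀ t, cov[X t, ξ; P] = m t)
    {A : Set (T → ℝ)} (hA : MeasurableSet A) (z : ℝ) :
    cdf (gaussianReal 0 1) (z - d) ≤ P.real {ω | (fun t ↦ X t ω) ∈ A} +
      Real.exp (z ^ 2 / 2) *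
        max 0 (cdf (gaussianReal 0 1) z - P.real {ω | (fun t ↦ X t ω + m t) ∈ A}) := by
  have hP : IsProbabilityMeasure P := hG.isProbabilityMeasure
  have hξL : P.map ξ = (gaussianReal 0 1).map (d * ·) := by
    have h := (hG.hasGaussianLaw_eval (.inr ())).map_eq_gaussianReal
    simp only [Sum.elim_inr] at h
    rw [h, hmean, hvar, gaussianReal_map_const_mul, mul_zero, mul_one]
    congr
    ext
    simp [sq_nonneg]
  have hξ2 : MemLp ξ 2 P := (hG.hasGaussianLaw_eval (.inr ())).memLp_two
  have hX2 : ∀ t, MemLp (X t) 2 P := fun t ↦ (hG.hasGaussianLaw_eval (.inl t)).memLp_two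
  -- If d = 0 then ξ vanishes almost surely and so does `m`; hence `e t * d ^ 2 = m t` holds even
  -- when `e` divides by zero.
  have hm0 : d = 0 → ∀ t, m t = 0 := fun h t ↦ by
    have h0 : ∀ᵐ ω ∂P, ξ ω = 0 := by
      have hl : HasLaw ξ (Measure.dirac 0) P := ⟨hξ.aemeasurable, by
        rw [hξL, h, gaussianReal_map_const_mul]
        simp⟩
      exact hl.ae_eq_of_dirac
    rw [← hm t, covariance]
    refine integral_eq_zero_of_ae ?_
    filter_upwards [h0] with ω hω
    simp [hω, hmean]
  set e : T → ℝ := fun t ↦ m t / d ^ 2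
  have he : ∀ t, e t * d ^ 2 = m t := fun t ↦ by
    by_cases h : d = 0
    · simp [h, hm0 h t]
    · simp only [e]
      field_simp
  -- Regression residual of X on ξ: uncorrelated with ξ, hence independent of it by joint
  -- Gaussianity.
  set R : T → Ω → ℝ := fun t ω ↦ X t ω - e t * ξ ω
  have hR : ∀ t, Measurable (R t) := fun t ↦ (hX t).sub (hξ.const_mul _)
  have hRm : Measurable fun ω t ↦ R t ω := measurable_pi_lambda _ hR
  have hGR : IsGaussianProcess (Sum.elim (fun _ : Unit ↦ ξ) R) P := by
    classical
    refine hG.of_isGaussianProcess fun s ↦ ?_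
    rcases s with s | t
    · exact ⟨{.inr ()}, ContinuousLinearMap.proj ⟨.inr (), by simp⟩, fun ω ↦ by simp⟩
    · exact ⟨{.inl t, .inr ()}, ContinuousLinearMap.proj ⟨.inl t, by simp⟩ -
        e t • ContinuousLinearMap.proj ⟨.inr (), by simp⟩, fun ω ↦ by simp [R]⟩
  have hind : IndepFun ξ (fun ω t ↦ R t ω) P := by
    have h := IsGaussianProcess.indepFun_of_covariance_eq_zero hGR (fun _ ↦ hξ.aemeasurable)
      (fun t ↦ (hR t).aemeasurable) (fun _ t ↦ by
        have h1 := covariance_fun_sub_right hξ2 (hX2 t) (hξ2.const_mul (e t))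
        rw [covariance_const_mul_right, covariance_comm ξ (X t), hm,
          covariance_self hξ.aemeasurable, hvar, he, sub_self] at h1
        exact h1)
    exact h.comp (φ := fun x : Unit → ℝ ↦ x ()) (measurable_pi_apply _) measurable_id
  set μR := P.map fun ω t ↦ R t ω
  have : IsProbabilityMeasure μR := Measure.isProbabilityMeasure_map hRm.aemeasurable
  have hlaw := (indepFun_iff_map_prod_eq_prod_map_map hξ.aemeasurable hRm.aemeasurable).1 hind
  rw [hξL] at hlaw
  set F : ℝ × (T → ℝ) → T → ℝ := fun q t ↦ q.2 t + e t * q.1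
  have hF : Measurable F := measurable_pi_lambda _ fun t ↦
    ((measurable_pi_apply t).comp measurable_snd).add (measurable_fst.const_mul _)
  -- Averaging over the residual leaves the conditional probability of `A` given ξ = dx, a
  -- randomised test in a standard normal variable.
  set ψ : ℝ → ℝ := fun x ↦ μR.real {r | F (d * x, r) ∈ A}
  have hφ : Measurable fun y ↦ μR {r | F (y, r) ∈ A} := measurable_measure_prodMk_left (hF hA)
  have hψ : Measurable ψ := (hφ.comp (measurable_const_mul d)).ennreal_toReal
  have hψ0 : ∀ x, 0 ≤ ψ x := fun x ↦ measureReal_nonneg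
  have hψ1 : ∀ x, ψ x ≤ 1 := fun x ↦ measureReal_le_one
  have key : ∀ b : ℝ, P.real {ω | F (ξ ω + d * b, fun t ↦ R t ω) ∈ A} =
      ∫ x, ψ (x + b) ∂(gaussianReal 0 1) := fun b ↦ by
    have hs : MeasurableSet {q : ℝ × (T → ℝ) | F (q.1 + d * b, q.2) ∈ A} :=
      (hF.comp ((measurable_fst.add_const _).prodMk measurable_snd)) hA
    have h1 := Measure.map_apply (μ := P) (hξ.prodMk hRm) hs
    rw [hlaw, Measure.prod_apply hs, lintegral_map (measurable_measure_prodMk_left hs)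
      (measurable_const_mul d)] at h1
    rw [integral_eq_lintegral_of_nonneg_ae (.of_forall fun x ↦ hψ0 _)
      (hψ.comp (measurable_add_const b)).aestronglyMeasurable, measureReal_def]
    congr 1
    refine h1.symm.trans (lintegral_congr fun x ↦ ?_)
    rw [ofReal_measureReal, mul_add]
    rfl
  have hA0 : {ω | (fun t ↦ X t ω) ∈ A} = {ω | F (ξ ω + d * 0, fun t ↦ R t ω) ∈ A} := by
    simp [F, R]
  -- Since m = e d², adding `m` to X moves ξ by d², which is a shift by d on the standard normal
  -- scale.
  have hAd : {ω | (fun t ↦ X t ω + m t) ∈ A} = {ω | F (ξ ω + d * d, fun t ↦ R t ω) ∈ A} := by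
    have : ∀ ω, (fun t ↦ X t ω + m t) = F (ξ ω + d * d, fun t ↦ R t ω) := fun ω ↦ by
      ext t
      simp only [F, R, ← he t]
      ring
    simp_rw [this]
  rw [hA0, hAd, key, key]
  simpa using cdf_sub_le_of_test hψ hψ0 hψ1 z hd

/-! ### Drifted Brownian paths -/

/-- Projecting `D` in `L²` onto the span of finitely many indicators of `(-1/2, t]`. -/
lemma exists_coeff_of_memLp {D : ℝ → ℝ} (hD : MemLp D 2 (volume.restrict obsInterval))
    {ι : Type*} [Fintype ι] (τ : ι → obsInterval) :
    ∃ c : ι → ℝ, (∀ i, ∑ j, c j * min ((τ i : ℝ) + 1 / 2) (τ j + 1 / 2) =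
        ∫ s in (-(1 / 2) : ℝ)..τ i, D s) ∧
      ∑ i, ∑ j, c i * c j * min ((τ i : ℝ) + 1 / 2) (τ j + 1 / 2) ≤ ∫ s in obsInterval, D s ^ 2 := by
  set μ : Measure ℝ := volume.restrict obsInterval
  set v : Lp ℝ 2 μ := hD.toLp D
  have hI : ∀ i, Ioc (-(1 / 2) : ℝ) (τ i) ⊆ obsInterval := fun i x hx ↦
    ⟨hx.1.le, hx.2.trans (τ i).2.2⟩
  -- The Gram matrix of these indicators is the covariance of Brownian motion started at -1/2, and
  -- their inner products with `D` are the values of the drift.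
  set e : ι → Lp ℝ 2 μ := fun i ↦
    indicatorConstLp 2 (measurableSet_Ioc (a := (-(1 / 2) : ℝ)) (b := τ i)) (measure_ne_top μ _) 1
  have hee : ∀ i j, inner ℝ (e i) (e j) = min ((τ i : ℝ) + 1 / 2) (τ j + 1 / 2) := fun i j ↦ by
    rw [L2.inner_indicatorConstLp_indicatorConstLp, Measure.real,
      Measure.restrict_apply (measurableSet_Ioc.inter measurableSet_Ioc),
      inter_eq_left.2 (inter_subset_left.trans (hI _)), Ioc_inter_Ioc, sup_idem, Real.volume_Ioc,
      ENNReal.toReal_ofReal, sub_neg_eq_add, ← min_add_add_right]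
    · simp
    · have h1 := (τ i).2.1
      have h2 := (τ j).2.1
      rw [sub_nonneg]
      exact le_min h1 h2
  have hev : ∀ i, inner ℝ (e i) v = ∫ s in (-(1 / 2) : ℝ)..τ i, D s := fun i ↦ by
    rw [L2.inner_indicatorConstLp_one, intervalIntegral.integral_of_le (τ i).2.1]
    have h : ∫ x in Ioc (-(1 / 2) : ℝ) (τ i), v x ∂μ = ∫ x in Ioc (-(1 / 2) : ℝ) (τ i), D x ∂μ :=
      integral_congr_ae (ae_restrict_of_ae hD.coeFn_toLp)
    rw [h, Measure.restrict_restrict measurableSet_Ioc, inter_eq_left.2 (hI i)]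
  have hvv : ‖v‖ ^ 2 = ∫ s in obsInterval, D s ^ 2 := by
    rw [← real_inner_self_eq_norm_sq, L2.inner_def]
    refine integral_congr_ae ?_
    filter_upwards [hD.coeFn_toLp] with x hx
    simp [v, hx, sq]
  set K := Submodule.span ℝ (range e)
  have : FiniteDimensional ℝ K := FiniteDimensional.span_of_finite ℝ (finite_range e)
  have hpK : K.starProjection v ∈ K := Submodule.starProjection_apply_mem K v
  obtain ⟨c, hc⟩ := (Submodule.mem_span_range_iff_exists_fun ℝ).1 hpK
  refine ⟨c, fun i ↦ ?_, ?_⟩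
  · have h := Submodule.starProjection_inner_eq_zero v (e i) (K := K)
      (Submodule.subset_span (mem_range_self i))
    rw [real_inner_comm, inner_sub_right, hev, ← hc, inner_sum] at h
    simp_rw [inner_smul_right, hee] at h
    linarith
  · rw [← hvv]
    have h : ‖K.starProjection v‖ ^ 2 ≤ ‖v‖ ^ 2 := by
      have := Submodule.norm_starProjection_apply_le K v
      gcongr
    refine le_of_eq_of_le ?_ h
    rw [← hc, ← real_inner_self_eq_norm_sq, sum_inner]
    refine Finset.sum_congr rfl fun i _ ↦ ?_
    rw [inner_sum]
    refine Finset.sum_congr rfl fun j _ ↦ ?_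
    rw [real_inner_smul_left, inner_smul_right, hee]
    ring

variable {Ω : Type*} [MeasurableSpace Ω] {P : Measure Ω} {B : ℝ≥0 → Ω → ℝ}

/-- The drift bound for events depending on finitely many coordinates of the path. -/
lemma cdf_sub_le_of_brownian_shift_cylinder (hBm : ∀ t, Measurable (B t))
    (hB : IsPreBrownianReal B P) {D : ℝ → ℝ} (hD : MemLp D 2 (volume.restrict obsInterval)) {d : ℝ}
    (hd : 0 ≤ d) (hDd : ∫ s in obsInterval, D s ^ 2 ≤ d ^ 2) (z : ℝ) {A : Set Path}
    (hA : A ∈ measurableCylinders fun _ : obsInterval ↦ ℝ) :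
    cdf (gaussianReal 0 1) (z - d) ≤
      P.real {ω | (fun t : obsInterval ↦ B ((t : ℝ) + 1 / 2).toNNReal ω) ∈ A} +
        Real.exp (z ^ 2 / 2) * max 0 (cdf (gaussianReal 0 1) z -
          P.real {ω | (fun t : obsInterval ↦ B ((t : ℝ) + 1 / 2).toNNReal ω +
            ∫ s in (-(1 / 2) : ℝ)..t, D s) ∈ A}) := by
  have hP : IsProbabilityMeasure P := hB.isGaussianProcess.isProbabilityMeasure
  obtain ⟨I, S, hS, rfl⟩ := (mem_measurableCylinders _).1 hA
  obtain ⟨c, hc, hcd⟩ := exists_coeff_of_memLp hD (fun i : I ↦ (i : obsInterval))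
  set θ : I → ℝ≥0 := fun i ↦ (((i : obsInterval) : ℝ) + 1 / 2).toNNReal
  have hθ : ∀ i, (θ i : ℝ) = ((i : obsInterval) : ℝ) + 1 / 2 := fun i ↦
    Real.coe_toNNReal _ (by linarith [(i : obsInterval).2.1])
  set X : I → Ω → ℝ := fun i ↦ B (θ i)
  -- By the choice of `c`, the covariances of ξ with the observed coordinates are the drift values,
  -- and Var ξ is the squared norm of the projection of `D`.
  set ξ : Ω → ℝ := fun ω ↦ ∑ j, c j * X j ω
  have hX2 : ∀ i, MemLp (X i) 2 P := fun i ↦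
    (hB.isGaussianProcess.hasGaussianLaw_eval (θ i)).memLp_two
  have hcX2 : ∀ i, MemLp (fun ω ↦ c i * X i ω) 2 P := fun i ↦ (hX2 i).const_mul _
  have hξm : Measurable ξ := Finset.measurable_sum _ fun i _ ↦ (hBm (θ i)).const_mul _
  have hcov : ∀ i, cov[X i, ξ; P] = ∫ s in (-(1 / 2) : ℝ)..(i : obsInterval), D s := fun i ↦ by
    rw [covariance_fun_sum_right hcX2 (hX2 i), ← hc i]
    refine Finset.sum_congr rfl fun j _ ↦ ?_
    rw [covariance_const_mul_right, hB.covariance_eval, NNReal.coe_min, hθ, hθ]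
  have hvar : Var[ξ; P] = ∑ i : I, ∑ j : I, c i * c j *
      min (((i : obsInterval) : ℝ) + 1 / 2) (((j : obsInterval) : ℝ) + 1 / 2) := by
    rw [← covariance_self hξm.aemeasurable, covariance_fun_sum_fun_sum hcX2 hcX2]
    refine Finset.sum_congr rfl fun i _ ↦ Finset.sum_congr rfl fun j _ ↦ ?_
    rw [covariance_const_mul_right, covariance_const_mul_left, hB.covariance_eval, NNReal.coe_min,
      hθ, hθ]
    ring
  have hmean : P[ξ] = 0 := by
    simp_rw [ξ]
    rw [integral_finsetSum _ fun i _ ↦ (hcX2 i).integrable (by norm_num)]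
    refine Finset.sum_eq_zero fun i _ ↦ ?_
    rw [integral_const_mul, hB.integral_eval, mul_zero]
  have hG : IsGaussianProcess (Sum.elim X fun _ : Unit ↦ ξ) P := by
    classical
    refine hB.isGaussianProcess.of_isGaussianProcess fun s ↦ ?_
    rcases s with i | _
    · exact ⟨{θ i}, ContinuousLinearMap.proj ⟨θ i, by simp⟩, fun ω ↦ by simp [X]⟩
    · have hmem : ∀ j, θ j ∈ Finset.univ.image θ := fun j ↦
        Finset.mem_image_of_mem _ (Finset.mem_univ j)
      exact ⟨Finset.univ.image θ,
        { toFun := fun x ↦ ∑ j, c j * x ⟨θ j, hmem j⟩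
          map_add' := fun x y ↦ by
            simp only [Pi.add_apply, mul_add, Finset.sum_add_distrib]
          map_smul' := fun a x ↦ by
            simp only [Pi.smul_apply, smul_eq_mul, RingHom.id_apply, Finset.mul_sum]
            exact Finset.sum_congr rfl fun j _ ↦ by ring }, fun ω ↦ rfl⟩
  have h := cdf_sub_le_of_gaussian_shift hG (fun i ↦ hBm (θ i)) hξm hmean
    (Real.sqrt_nonneg Var[ξ; P]) (Real.sq_sqrt (variance_nonneg _ _)).symm hcov hS z
  refine le_trans (monotone_cdf _ (sub_le_sub_left ?_ z)) h
  rw [Real.sqrt_le_left hd, hvar]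
  exact hcd.trans hDd

/-- Two-point testing bound for a Brownian path with a square integrable drift: an event whose
probability under the drift `D` is at least `Φ(z)` has probability at least `Φ(z - ‖D‖)` without
drift. -/
lemma cdf_sub_le_of_brownian_shift (hBm : ∀ t, Measurable (B t))
    (hB : IsPreBrownianReal B P) {D : ℝ → ℝ} (hD : MemLp D 2 (volume.restrict obsInterval)) {d : ℝ}
    (hd : 0 ≤ d) (hDd : ∫ s in obsInterval, D s ^ 2 ≤ d ^ 2) {z : ℝ} {A : Set Path}
    (hA : MeasurableSet A)
    (hz : cdf (gaussianReal 0 1) z ≤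
      P.real {ω | (fun t : obsInterval ↦ B ((t : ℝ) + 1 / 2).toNNReal ω +
            ∫ s in (-(1 / 2) : ℝ)..t, D s) ∈ A}) :
    cdf (gaussianReal 0 1) (z - d) ≤
      P.real {ω | (fun t : obsInterval ↦ B ((t : ℝ) + 1 / 2).toNNReal ω) ∈ A} := by
  have hP : IsProbabilityMeasure P := hB.isGaussianProcess.isProbabilityMeasure
  set Y₀ : Ω → Path := fun ω t ↦ B ((t : ℝ) + 1 / 2).toNNReal ω
  set Y₁ : Ω → Path := fun ω t ↦ B ((t : ℝ) + 1 / 2).toNNReal ω + ∫ s in (-(1 / 2) : ℝ)..t, D s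
  have hY₀ : Measurable Y₀ := measurable_pi_lambda _ fun t ↦ hBm _
  have hY₁ : Measurable Y₁ := measurable_pi_lambda _ fun t ↦ (hBm _).add_const _
  have : IsProbabilityMeasure (P.map Y₀) := Measure.isProbabilityMeasure_map hY₀.aemeasurable
  have : IsProbabilityMeasure (P.map Y₁) := Measure.isProbabilityMeasure_map hY₁.aemeasurable
  refine le_of_forall_pos_le_add fun ε hε ↦ ?_
  -- Splits ε between the driftless error, with weight 1, and the power deficit, with weight
  -- exp(z²/2).
  set κ := 1 + Real.exp (z ^ 2 / 2)
  have hκ : 0 < κ := by positivity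
  -- Approximating in the sum of the two laws gives one cylinder close to `A` under both.
  obtain ⟨A', hA', hAA'⟩ := (Measure.MeasureDense.of_generateFrom_isSetAlgebra_finite
    (μ := P.map Y₀ + P.map Y₁) (isSetAlgebra_measurableCylinders (α := fun _ : obsInterval ↦ ℝ))
    generateFrom_measurableCylinders.symm).approx A hA (measure_ne_top _ _) (ε / κ) (by positivity)
  have hA'm := MeasurableSet.of_mem_measurableCylinders hA'
  have hbound : ∀ {Y : Ω → Path}, Measurable Y → P.map Y ≤ P.map Y₀ + P.map Y₁ →
      |P.real {ω | Y ω ∈ A} - P.real {ω | Y ω ∈ A'}| ≤ ε / κ := fun {Y} hY hle ↦ by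
    have : IsProbabilityMeasure (P.map Y) := Measure.isProbabilityMeasure_map hY.aemeasurable
    have h1 : P.real {ω | Y ω ∈ A} = (P.map Y).real A := (map_measureReal_apply hY hA).symm
    have h2 : P.real {ω | Y ω ∈ A'} = (P.map Y).real A' := (map_measureReal_apply hY hA'm).symm
    rw [h1, h2]
    refine (abs_measureReal_sub_le_measureReal_symmDiff hA.nullMeasurableSet
      hA'm.nullMeasurableSet).trans ?_
    exact ENNReal.toReal_le_of_le_ofReal (by positivity) ((hle _).trans hAA'.le)
  have h0 := abs_le.1 (hbound hY₀ (Measure.le_add_right le_rfl))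
  have h1 := abs_le.1 (hbound hY₁ (Measure.le_add_left le_rfl))
  have h := cdf_sub_le_of_brownian_shift_cylinder hBm hB hD hd hDd z hA'
  have hmax : max 0 (cdf (gaussianReal 0 1) z - P.real {ω | Y₁ ω ∈ A'}) ≤ ε / κ :=
    max_le (by positivity) (by linarith [h1.2])
  have hκε : ε / κ + Real.exp (z ^ 2 / 2) * (ε / κ) = ε := by
    simp only [κ]
    field_simp
  have := mul_le_mul_of_nonneg_left hmax (Real.exp_pos (z ^ 2 / 2)).le
  change _ ≤ P.real {ω | Y₀ ω ∈ A'} + _ * max 0 (_ - P.real {ω | Y₁ ω ∈ A'}) at h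
  linarith [h0.1]

/-! ### Testing and expected length in the white noise model -/

lemma measurable_obsPath (hBm : ∀ t, Measurable (B t)) (n : ℝ) (f : ℝ → ℝ) :
    Measurable (obsPath B n f) :=
  measurable_pi_lambda _ fun _ ↦ ((hBm _).const_mul _).const_add _

lemma intervalIntegrable_of_mem {f : ℝ → ℝ} (hf : IntegrableOn f obsInterval) {a b : ℝ}
    (ha : a ∈ obsInterval) (hb : b ∈ obsInterval) : IntervalIntegrable f volume a b :=
  (hf.mono_set (uIcc_subset_Icc ha hb)).intervalIntegrable

/-- Two-point testing bound in the white noise model. -/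
lemma cdf_sub_le_of_obsPath (hBm : ∀ t, Measurable (B t)) (hB : IsPreBrownianReal B P)
    {n : ℝ} (hn : 0 < n) {f D : ℝ → ℝ} (hf : IntegrableOn f obsInterval)
    (hD : MemLp D 2 (volume.restrict obsInterval)) {d : ℝ}
    (hd : 0 ≤ d) (hDd : n * ∫ s in obsInterval, D s ^ 2 ≤ d ^ 2) {z : ℝ} {A : Set Path}
    (hA : MeasurableSet A)
    (hz : cdf (gaussianReal 0 1) z ≤ P.real {ω | obsPath B n (fun x ↦ f x + D x) ω ∈ A}) :
    cdf (gaussianReal 0 1) (z - d) ≤ P.real {ω | obsPath B n f ω ∈ A} := by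
  have hDi : IntegrableOn D obsInterval := hD.integrable (by norm_num)
  -- Undoing `G` turns the two observations into B and B with drift √n D.
  set G : Path → Path := fun y t ↦ (∫ s in (-(1 / 2) : ℝ)..t, f s) + (√n)⁻¹ * y t
  have hG : Measurable G := measurable_pi_lambda _ fun t ↦
    ((measurable_pi_apply t).const_mul _).const_add _
  have hsq : √n ≠ 0 := (Real.sqrt_pos.2 hn).ne'
  have h1 : ∀ ω, obsPath B n (fun x ↦ f x + D x) ω =
      G fun t ↦ B ((t : ℝ) + 1 / 2).toNNReal ω + ∫ s in (-(1 / 2) : ℝ)..t, √n * D s := fun ω ↦ by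
    ext t
    have hl : (-(1 / 2) : ℝ) ∈ obsInterval := by norm_num
    simp only [obsPath, obs, G]
    rw [intervalIntegral.integral_add (intervalIntegrable_of_mem hf hl t.2)
      (intervalIntegrable_of_mem hDi hl t.2), intervalIntegral.integral_const_mul]
    field_simp
    ring
  simp_rw [h1] at hz
  refine cdf_sub_le_of_brownian_shift hBm hB (hD.const_mul (√n)) hd ?_ (hG hA) hz
  simp_rw [mul_pow, Real.sq_sqrt hn.le]
  rwa [integral_const_mul]

/-- The expected length at `f` is the integral over `x` of the coverage probability of `x`. -/
lemma expectedLength_eq_lintegral [SFinite P] (hBm : ∀ t, Measurable (B t)) (n : ℝ) (f : ℝ → ℝ)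
    (C : ConfInterval) :
    expectedLength P B n f C = ∫⁻ x, P {ω | x ∈ C.toSet (obsPath B n f ω)} := by
  have hs : MeasurableSet {q : Ω × ℝ | q.2 ∈ C.toSet (obsPath B n f q.1)} :=
    (((measurable_obsPath hBm n f).comp measurable_fst).prodMk measurable_snd)
      C.measurableSet_graph
  exact (Measure.prod_apply (μ := P) (ν := volume) hs).symm.trans (Measure.prod_apply_symm hs)

/-- Lower bound for the benchmark from a segment `f + lam * D` of functions in the class. -/
lemma le_benchmark_of_segment (hBm : ∀ t, Measurable (B t)) (hB : IsPreBrownianReal B P)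
    {n : ℝ} (hn : 0 < n) {α z h : ℝ} (hz : 0 < z) (hh : 0 < h)
    (hα : cdf (gaussianReal 0 1) z = 1 - α) {F : Set (ℝ → ℝ)} {f D : ℝ → ℝ}
    (hf : IntegrableOn f obsInterval) (hD : MemLp D 2 (volume.restrict obsInterval))
    (hD0 : D 0 = h) (hDz : n * ∫ s in obsInterval, D s ^ 2 ≤ z ^ 2)
    (hF : ∀ lam ∈ Icc (0 : ℝ) 1, (fun x ↦ f x + lam * D x) ∈ F) :
    ENNReal.ofReal (h / z * (z - 1 / √(2 * Real.pi))) ≤ benchmark P B n α f F := by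
  have hP : IsProbabilityMeasure P := hB.isGaussianProcess.isProbabilityMeasure
  refine le_iInf₂ fun C hC ↦ ?_
  rw [expectedLength_eq_lintegral hBm]
  have hcov : ∀ x ∈ Ioc (f 0) (f 0 + h),
      ENNReal.ofReal (cdf (gaussianReal 0 1) (z + z / h * f 0 - z / h * x)) ≤
        P {ω | x ∈ C.toSet (obsPath B n f ω)} := fun x hx ↦ by
    set lam := (x - f 0) / h
    have hlam : lam ∈ Icc (0 : ℝ) 1 :=
      ⟨div_nonneg (by linarith [hx.1]) hh.le, (div_le_one hh).2 (by linarith [hx.2])⟩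
    have hx0 : f 0 + lam * D 0 = x := by
      rw [hD0, div_mul_cancel₀ _ hh.ne']
      ring
    have hCx := hC _ (hF lam hlam)
    simp only [hx0] at hCx
    have hA : MeasurableSet {y : Path | x ∈ C.toSet y} :=
      measurable_prodMk_right C.measurableSet_graph
    have hint : n * ∫ s in obsInterval, (lam * D s) ^ 2 ≤ (lam * z) ^ 2 := by
      simp_rw [mul_pow]
      rw [integral_const_mul]
      nlinarith [mul_le_mul_of_nonneg_left hDz (sq_nonneg lam)]
    have h := cdf_sub_le_of_obsPath hBm hB hn hf (hD.const_mul lam)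
      (mul_nonneg hlam.1 hz.le) hint hA
      (z := z) (by
        rw [hα]
        exact (ENNReal.ofReal_le_iff_le_toReal (measure_ne_top _ _)).1 hCx)
    refine ENNReal.ofReal_le_of_le_toReal (le_of_eq_of_le ?_ h)
    congr 1
    simp only [lam]
    field_simp
    ring
  have hc : Continuous fun x ↦ cdf (gaussianReal 0 1) (z + z / h * f 0 - z / h * x) :=
    continuous_cdf_gaussianReal.comp (by fun_prop)
  calc ENNReal.ofReal (h / z * (z - 1 / √(2 * Real.pi)))
      ≤ ENNReal.ofReal (∫ x in (f 0)..(f 0 + h),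
          cdf (gaussianReal 0 1) (z + z / h * f 0 - z / h * x)) := by
        refine ENNReal.ofReal_le_ofReal ?_
        -- The affine substitution sends f(0) to z and f(0) + h to 0.
        rw [intervalIntegral.integral_comp_sub_mul _ (div_pos hz hh).ne', inv_div, smul_eq_mul]
        refine mul_le_mul_of_nonneg_left ?_ (div_pos hh hz).le
        have e1 : z + z / h * f 0 - z / h * (f 0 + h) = 0 := by
          field_simp
          ring
        have e2 : z + z / h * f 0 - z / h * f 0 = z := by ring
        rw [e1, e2]
        exact le_integral_cdf hz.le
    _ = ∫⁻ x in Ioc (f 0) (f 0 + h),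
          ENNReal.ofReal (cdf (gaussianReal 0 1) (z + z / h * f 0 - z / h * x)) := by
        rw [intervalIntegral.integral_of_le (by linarith), ofReal_integral_eq_lintegral_ofReal
          hc.integrableOn_Ioc (.of_forall fun _ ↦ cdf_nonneg _ _)]
    _ ≤ ∫⁻ x in Ioc (f 0) (f 0 + h), P {ω | x ∈ C.toSet (obsPath B n f ω)} :=
        setLIntegral_mono' measurableSet_Ioc hcov
    _ ≤ _ := setLIntegral_le_lintegral _ _

/-! ### Convex functions and their chords -/

section Convex

variable {f : ℝ → ℝ}

lemma neg_mem_obsInterval {x : ℝ} (hx : x ∈ obsInterval) : -x ∈ obsInterval :=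
  ⟨by linarith [hx.2], by linarith [hx.1]⟩

lemma mul_le_of_mem_convexClass (hf : f ∈ convexClass) {a b c : ℝ} (ha : a ∈ obsInterval)
    (hc : c ∈ obsInterval) (hab : a ≤ b) (hbc : b ≤ c) :
    (c - a) * f b ≤ (c - b) * f a + (b - a) * f c := by
  rcases eq_or_lt_of_le (hab.trans hbc) with h | h
  · obtain rfl : a = b := by linarith
    simp [h]
  · have hca : 0 < c - a := by linarith
    have hj := hf.2 ha hc (show 0 ≤ (c - b) / (c - a) from div_nonneg (by linarith) hca.le)
      (show 0 ≤ (b - a) / (c - a) from div_nonneg (by linarith) hca.le) (by field_simp; ring)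
    have hb : ((c - b) / (c - a)) • a + ((b - a) / (c - a)) • c = b := by
      simp only [smul_eq_mul]
      field_simp
      ring
    rw [hb, smul_eq_mul, smul_eq_mul] at hj
    calc (c - a) * f b ≤ (c - a) * ((c - b) / (c - a) * f a + (b - a) / (c - a) * f c) := by
          gcongr
      _ = _ := by field_simp

lemma two_mul_le_of_mem_convexClass (hf : f ∈ convexClass) {x : ℝ} (hx : x ∈ obsInterval) :
    2 * f 0 ≤ f x + f (-x) := by
  wlog h : 0 ≤ x generalizing x
  · have := this (neg_mem_obsInterval hx) (by linarith)
    rw [neg_neg] at this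
    linarith
  rcases eq_or_lt_of_le h with rfl | h0
  · simp
    linarith
  · have := mul_le_of_mem_convexClass hf (neg_mem_obsInterval hx) hx (b := 0) (by linarith) h
    refine le_of_mul_le_mul_left ?_ h0
    linarith

/-- Endpoint values bound f above; reflection, f(x) ≥ 2f(0) - f(-x), then bounds it below. -/
lemma exists_bound_of_mem_convexClass (hf : f ∈ convexClass) :
    ∃ M, ∀ x ∈ obsInterval, |f x| ≤ M := by
  set m := max (f (-(1 / 2))) (f (1 / 2))
  have hu : ∀ x ∈ obsInterval, f x ≤ m := fun x hx ↦
    ConvexOn.le_max_of_mem_Icc hf (by norm_num) (by norm_num) hx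
  refine ⟨|m| + 2 * |f 0|, fun x hx ↦ abs_le.2 ⟨?_, ?_⟩⟩
  · have h1 := two_mul_le_of_mem_convexClass hf hx
    have h2 := hu _ (neg_mem_obsInterval hx)
    linarith [neg_abs_le (f 0), le_abs_self m]
  · linarith [hu x hx, le_abs_self m, abs_nonneg (f 0)]

lemma memLp_of_mem_convexClass (hf : f ∈ convexClass) (p : ℝ≥0∞) :
    MemLp f p (volume.restrict obsInterval) := by
  obtain ⟨M, hM⟩ := exists_bound_of_mem_convexClass hf
  refine MemLp.of_bound ?_ M
    ((ae_restrict_iff' measurableSet_Icc).2 (.of_forall fun x hx ↦ hM x hx))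
  -- Convexity gives continuity only in the interior; f may jump at the endpoints, which are null.
  rw [← Measure.restrict_congr_set Ioo_ae_eq_Icc]
  have h := ConvexOn.continuousOn_interior hf
  rw [interior_Icc] at h
  exact h.aestronglyMeasurable measurableSet_Ioo

lemma integrableOn_of_mem_convexClass (hf : f ∈ convexClass) : IntegrableOn f obsInterval :=
  (memLp_of_mem_convexClass hf 1).integrable le_rfl

/-- The affine function through the points of the graph of `f` at `-u` and `u`. -/
noncomputable def chord (f : ℝ → ℝ) (u x : ℝ) : ℝ := (f u + f (-u)) / 2 + (f u - f (-u)) / (2 * u) * x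

lemma le_chord (hf : f ∈ convexClass) {u x : ℝ} (hu : u ∈ obsInterval) (hu0 : 0 < u)
    (hx : |x| ≤ u) : f x ≤ chord f u x := by
  have h := mul_le_of_mem_convexClass hf (neg_mem_obsInterval hu) hu
    (abs_le.1 hx).1 (abs_le.1 hx).2
  have hc : (u - -u) * chord f u x = (u - x) * f (-u) + (x - -u) * f u := by
    simp only [chord]
    field_simp
    ring
  exact le_of_mul_le_mul_left (h.trans hc.ge) (by linarith)

lemma chord_le (hf : f ∈ convexClass) {u x : ℝ} (hu : u ∈ obsInterval) (hu0 : 0 < u)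
    (hx : x ∈ obsInterval) (hxu : u < |x|) : chord f u x ≤ f x := by
  have hu' := neg_mem_obsInterval hu
  have hc : 2 * u * chord f u x = (u + x) * f u + (u - x) * f (-u) := by
    simp only [chord]
    field_simp
    ring
  refine le_of_mul_le_mul_left ?_ (show 0 < 2 * u by linarith)
  rw [hc]
  rcases lt_abs.1 hxu with h | h
  · linarith [mul_le_of_mem_convexClass hf hu' hx (b := u) (by linarith) h.le]
  · linarith [mul_le_of_mem_convexClass hf hx hu (b := -u) (by linarith) (by linarith)]

/-- Raising a convex function to its chord over `[-u, u]` stays within the class. -/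
lemma add_mul_max_chord_mem_convexClass (hf : f ∈ convexClass) (u : ℝ) {lam : ℝ}
    (hlam : lam ∈ Icc (0 : ℝ) 1) :
    (fun x ↦ f x + lam * max 0 (chord f u x - f x)) ∈ convexClass := by
  have hc : ConvexOn ℝ obsInterval (chord f u) := by
    have h : ConvexOn ℝ obsInterval (((f u - f (-u)) / (2 * u)) • LinearMap.id (R := ℝ) (M := ℝ)) :=
      LinearMap.convexOn _ (convex_Icc _ _)
    exact (h.add_const ((f u + f (-u)) / 2)).congr fun x _ ↦ by simp [chord]; ring
  -- The raised function is (1 - λ) f + λ max(f, chord).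
  have h := (ConvexOn.smul (sub_nonneg.2 hlam.2) hf).add
    (ConvexOn.smul hlam.1 (ConvexOn.sup hf hc))
  refine ConvexOn.congr (f := _) (g := fun x ↦ f x + lam * max 0 (chord f u x - f x)) h
    fun x _ ↦ ?_
  have : max (f x) (chord f u x) = f x + max 0 (chord f u x - f x) := by
    rw [← max_add_add_left]
    simp
  simp [this]
  ring

lemma memLp_max_chord (hf : f ∈ convexClass) (u : ℝ) :
    MemLp (fun x ↦ max 0 (chord f u x - f x)) 2 (volume.restrict obsInterval) := by
  have hg : (fun x ↦ f x + 1 * max 0 (chord f u x - f x)) ∈ convexClass :=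
    add_mul_max_chord_mem_convexClass hf u (by norm_num)
  have h := (memLp_of_mem_convexClass hg 2).sub (memLp_of_mem_convexClass hf 2)
  convert h using 1
  ext x
  simp

/-- Pairing x with -x gains a factor 2: the two gaps are nonnegative with sum at most 2d, so their
squares sum to at most 4d², whereas each gap alone could approach 2d. -/
lemma integral_sq_max_chord_le (hf : f ∈ convexClass) {u : ℝ} (hu : u ∈ obsInterval)
    (hu0 : 0 < u) :
    ∫ x in obsInterval, max 0 (chord f u x - f x) ^ 2 ≤
      4 * u * ((f u + f (-u)) / 2 - f 0) ^ 2 := by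
  set d := (f u + f (-u)) / 2 - f 0
  set E : ℝ → ℝ := fun x ↦ max 0 (chord f u x - f x)
  have hE : MemLp E 2 (volume.restrict obsInterval) := memLp_max_chord hf u
  have hEi : IntervalIntegrable (fun x ↦ E x ^ 2) volume (-(1 / 2)) (1 / 2) := by
    rw [intervalIntegrable_iff_integrableOn_Icc_of_le (by norm_num)]
    exact hE.integrable_sq
  have hEi' : IntervalIntegrable (fun x ↦ E (-x) ^ 2) volume (-(1 / 2)) (1 / 2) := by
    simpa using ((IntervalIntegrable.iff_comp_neg).1 hEi).symm
  have hsum : ∀ x ∈ obsInterval,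
      E x ^ 2 + E (-x) ^ 2 ≤ (Icc (-u) u).indicator (fun _ ↦ (2 * d) ^ 2) x := fun x hx ↦ by
    by_cases hxu : |x| ≤ u
    · rw [indicator_of_mem (show x ∈ Icc (-u) u from abs_le.1 hxu)]
      have h1 : E x = chord f u x - f x := max_eq_right (sub_nonneg.2 (le_chord hf hu hu0 hxu))
      have h2 : E (-x) = chord f u (-x) - f (-x) :=
        max_eq_right (sub_nonneg.2 (le_chord hf hu hu0 (by rwa [abs_neg])))
      have h3 : E x + E (-x) ≤ 2 * d := by
        rw [h1, h2]
        simp only [chord, d]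
        linarith [two_mul_le_of_mem_convexClass hf hx]
      have h4 : 0 ≤ E x := le_max_left _ _
      have h5 : 0 ≤ E (-x) := le_max_left _ _
      nlinarith [mul_nonneg h4 h5]
    · have h1 : E x = 0 := max_eq_left (sub_nonpos.2 (chord_le hf hu hu0 hx (not_le.1 hxu)))
      have h2 : E (-x) = 0 := max_eq_left (sub_nonpos.2
        (chord_le hf hu hu0 (neg_mem_obsInterval hx) (by rw [abs_neg]; exact not_le.1 hxu)))
      rw [h1, h2, indicator_of_notMem (show x ∉ Icc (-u) u from fun h ↦ hxu (abs_le.2 h))]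
      norm_num
  have hneg : ∫ x in (-(1 / 2) : ℝ)..(1 / 2), E (-x) ^ 2 =
      ∫ x in (-(1 / 2) : ℝ)..(1 / 2), E x ^ 2 := by
    rw [intervalIntegral.integral_comp_neg fun x ↦ E x ^ 2, neg_neg]
  have hind : Integrable ((Icc (-u) u).indicator fun _ ↦ (2 * d) ^ 2) (volume.restrict obsInterval) :=
    (integrable_const _).indicator measurableSet_Icc
  have hle : ∫ x in (-(1 / 2) : ℝ)..(1 / 2), (E x ^ 2 + E (-x) ^ 2) ≤ 2 * u * (2 * d) ^ 2 := by
    rw [intervalIntegral.integral_of_le (by norm_num), ← integral_Icc_eq_integral_Ioc]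
    refine (setIntegral_mono_on ?_ hind measurableSet_Icc hsum).trans ?_
    · exact (intervalIntegrable_iff_integrableOn_Icc_of_le (by norm_num)).1 (hEi.add hEi')
    · rw [integral_indicator measurableSet_Icc, Measure.restrict_restrict measurableSet_Icc,
        inter_eq_left.2 (Icc_subset_Icc (neg_mem_obsInterval hu).1 hu.2), setIntegral_const,
        Real.volume_real_Icc_of_le (by linarith), smul_eq_mul]
      linarith
  rw [intervalIntegral.integral_add hEi hEi', hneg,
    intervalIntegral.integral_of_le (by norm_num), ← integral_Icc_eq_integral_Ioc] at hle
  linarith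

lemma integral_symm_bounds (hf : f ∈ convexClass) {u : ℝ} (hu : u ∈ obsInterval) (hu0 : 0 < u) :
    2 * u * f 0 ≤ ∫ x in -u..u, f x ∧ ∫ x in -u..u, f x ≤ 2 * u * ((f u + f (-u)) / 2) := by
  have hi : IntervalIntegrable f volume (-u) u :=
    intervalIntegrable_of_mem (integrableOn_of_mem_convexClass hf) (neg_mem_obsInterval hu) hu
  have hi' : IntervalIntegrable (fun x ↦ f (-x)) volume (-u) u := by
    simpa using ((IntervalIntegrable.iff_comp_neg).1 hi).symm
  have hs : ∫ x in -u..u, (f x + f (-x)) = 2 * ∫ x in -u..u, f x := by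
    rw [intervalIntegral.integral_add hi hi', intervalIntegral.integral_comp_neg f, neg_neg]
    ring
  have hle : -u ≤ u := by linarith
  have hmem : ∀ x ∈ Icc (-u) u, x ∈ obsInterval := fun x hx ↦
    Icc_subset_Icc (neg_mem_obsInterval hu).1 hu.2 hx
  have h1 := intervalIntegral.integral_mono_on hle intervalIntegrable_const (hi.add hi')
    (f := fun _ ↦ 2 * f 0) fun x hx ↦ two_mul_le_of_mem_convexClass hf (hmem x hx)
  have h2 := intervalIntegral.integral_mono_on hle (hi.add hi') intervalIntegrable_const
    (g := fun _ ↦ f u + f (-u)) fun x hx ↦ by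
      have hx1 := le_chord hf hu hu0 (abs_le.2 hx)
      have hx2 := le_chord hf hu hu0 (x := -x) (by rw [abs_neg]; exact abs_le.2 hx)
      simp only [chord] at hx1 hx2
      linarith
  rw [intervalIntegral.integral_const, smul_eq_mul] at h1 h2
  constructor <;> linarith

end Convex

/-! ### Means of the statistics and existence of a scale -/

variable {f : ℝ → ℝ}

lemma two_zpow_neg_mem_obsInterval {j : ℕ} (hj : 1 ≤ j) :
    (2 : ℝ) ^ (-(j : ℤ)) ∈ obsInterval := by
  have h0 : (0 : ℝ) < 2 ^ (-(j : ℤ)) := by positivity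
  have h1 : (2 : ℝ) ^ (-(j : ℤ)) ≤ 2 ^ (-1 : ℤ) := zpow_le_zpow_right₀ (by norm_num) (by lia)
  exact ⟨by linarith, h1.trans (by norm_num)⟩

lemma integrable_obs (hB : IsPreBrownianReal B P) (n : ℝ) (f : ℝ → ℝ) (t : ℝ) :
    Integrable (obs B n f t) P := by
  have hP : IsProbabilityMeasure P := hB.isGaussianProcess.isProbabilityMeasure
  exact (integrable_const _).add ((hB.integrable_eval _).const_mul _)

lemma integral_obs (hB : IsPreBrownianReal B P) (n : ℝ) (f : ℝ → ℝ) (t : ℝ) :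
    ∫ ω, obs B n f t ω ∂P = ∫ s in (-(1 / 2) : ℝ)..t, f s := by
  have hP : IsProbabilityMeasure P := hB.isGaussianProcess.isProbabilityMeasure
  simp only [obs]
  rw [integral_add (integrable_const _) ((hB.integrable_eval _).const_mul _),
    integral_const_mul, hB.integral_eval]
  simp

lemma integrable_delta (hB : IsPreBrownianReal B P) (n : ℝ) (f : ℝ → ℝ) (j : ℕ) :
    Integrable (delta B n f j) P :=
  ((integrable_obs hB n f _).sub (integrable_obs hB n f _)).const_mul _

/-- The mean of δ_j is the average of f over [-2^{-j}, 2^{-j}], so this is the Hermite–Hadamard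
inequality. -/
lemma integral_delta_bounds (hB : IsPreBrownianReal B P) (n : ℝ) (hf : f ∈ convexClass) {j : ℕ}
    (hj : 1 ≤ j) :
    f 0 ≤ ∫ ω, delta B n f j ω ∂P ∧
      ∫ ω, delta B n f j ω ∂P ≤ (f (2 ^ (-(j : ℤ))) + f (-2 ^ (-(j : ℤ)))) / 2 := by
  set u : ℝ := 2 ^ (-(j : ℤ)) with hu_def
  have hu := two_zpow_neg_mem_obsInterval hj
  have hu0 : 0 < u := by positivity
  have hl : (-(1 / 2) : ℝ) ∈ obsInterval := by norm_num
  have hfi := integrableOn_of_mem_convexClass hf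
  have h : ∫ ω, delta B n f j ω ∂P = (2 * u)⁻¹ * ∫ x in -u..u, f x := by
    simp only [delta]
    rw [integral_const_mul, integral_sub (integrable_obs hB n f _) (integrable_obs hB n f _),
      integral_obs hB, integral_obs hB, intervalIntegral.integral_interval_sub_left
        (intervalIntegrable_of_mem hfi hl hu)
        (intervalIntegrable_of_mem hfi hl (neg_mem_obsInterval hu))]
    congr 1
    rw [hu_def, zpow_sub₀ two_ne_zero, zpow_neg]
    simp
    ring
  obtain ⟨h1, h2⟩ := integral_symm_bounds hf hu hu0
  rw [h, inv_mul_eq_div]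
  exact ⟨(le_div_iff₀' (by positivity)).2 h1, (div_le_iff₀' (by positivity)).2 h2⟩

lemma integral_tStat_le (hB : IsPreBrownianReal B P) (n : ℝ) (hf : f ∈ convexClass) {j : ℕ}
    (hj : 1 ≤ j) :
    ∫ ω, tStat B n f j ω ∂P ≤ (f (2 ^ (-(j : ℤ))) + f (-2 ^ (-(j : ℤ)))) / 2 - f 0 := by
  simp only [tStat]
  rw [integral_sub (integrable_delta hB n f j) (integrable_delta hB n f (j + 1))]
  linarith [(integral_delta_bounds hB n hf hj).2,
    (integral_delta_bounds hB n hf (Nat.le_add_left 1 j)).1]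

lemma sq_sigma {n : ℝ} (hn : 0 < n) (j : ℕ) : sigma n j ^ 2 = 2 ^ ((j : ℤ) - 1) / n :=
  Real.sq_sqrt (by positivity)

lemma sigma_pos {n : ℝ} (hn : 0 < n) (j : ℕ) : 0 < sigma n j :=
  Real.sqrt_pos.2 (by positivity)

lemma sigma_succ (n : ℝ) (j : ℕ) : sigma n (j + 1) = √2 * sigma n j := by
  rw [sigma, sigma, ← Real.sqrt_mul (by norm_num)]
  congr 1
  push_cast
  rw [add_sub_right_comm, zpow_add_one₀ two_ne_zero]
  ring

/-- E T_j is at most 2M when |f| ≤ M, while σ_j grows without bound; σ_j ≥ 3M/z suffices. -/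
lemma scaleSet_nonempty (hB : IsPreBrownianReal B P) {n α : ℝ} (hn : 0 < n)
    (hz : 0 < zQuantile α) (hf : f ∈ convexClass) : (scaleSet P B n α f).Nonempty := by
  obtain ⟨M, hM⟩ := exists_bound_of_mem_convexClass hf
  obtain ⟨k, hk⟩ := pow_unbounded_of_one_lt (n * (3 * M / zQuantile α) ^ 2)
    (show (1 : ℝ) < 2 by norm_num)
  have hj : 1 ≤ k + 1 := by lia
  refine ⟨k + 1, hj, (integral_tStat_le hB n hf hj).trans ?_⟩
  have hu := two_zpow_neg_mem_obsInterval hj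
  have h0 := (abs_le.1 (hM 0 (by norm_num))).1
  have h1 := (abs_le.1 (hM _ hu)).2
  have h2 := (abs_le.1 (hM _ (neg_mem_obsInterval hu))).2
  have hσ : 3 * M / zQuantile α ≤ sigma n (k + 1) := by
    refine Real.le_sqrt_of_sq_le ?_
    rw [le_div_iff₀ hn]
    push_cast
    rw [add_sub_cancel_right, zpow_natCast]
    linarith
  rw [div_le_iff₀ hz] at hσ
  linarith

end WhiteNoise

/-! ### The lower bound at the critical scale -/

theorem theorem5 {Ω : Type*} [MeasurableSpace Ω] (P : Measure Ω) (B : ℝ≥0 → Ω → ℝ)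
    (hBm : ∀ t, Measurable (B t)) (hB : IsBrownianReal B P)
    (n : ℝ) (hn : 0 < n) (α : ℝ) (hα0 : 0 < α) (hα1 : α ≤ 0.2)
    (f : ℝ → ℝ) (hf : f ∈ convexClass) :
    (scaleSet P B n α f).Nonempty ∧
      ENNReal.ofReal ((1 - 1 / (√(2 * Real.pi) * zQuantile α)) * (√2 / 3) * zQuantile α *
          sigma n (jStar P B n α f)) ≤
        benchmark P B n α f convexClass := by
  have hα2 : α < 1 / 2 := by norm_num at hα1; linarith
  have hz := zQuantile_pos hα0 hα2
  have hcdf := cdf_zQuantile hα0 (by linarith)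
  have hBp := hB.toIsPreBrownianReal
  have hne := scaleSet_nonempty hBp hn hz hf
  refine ⟨hne, ?_⟩
  set z := zQuantile α
  set j := jStar P B n α f with hj_def
  have hj1 : 1 ≤ j := (Nat.sInf_mem hne).1
  have hσ := sigma_pos hn j
  have hπ : 0 < √(2 * Real.pi) := by positivity
  set h := √2 / 3 * z * sigma n j with h_def
  have hh : 0 < h := by positivity
  have h2 : √2 ^ 2 = 2 := Real.sq_sqrt (by norm_num)
  have hgoal : (1 - 1 / (√(2 * Real.pi) * z)) * (√2 / 3) * z * sigma n j =
      h / z * (z - 1 / √(2 * Real.pi)) := by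
    rw [h_def]
    field_simp
  rw [hgoal]
  have hfi := integrableOn_of_mem_convexClass hf
  obtain ⟨k, hk⟩ : ∃ k, j = k + 1 := ⟨j - 1, by lia⟩
  rcases Nat.eq_zero_or_pos k with rfl | hk0
  -- No coarser scale is available at j = 1; the constant shift costs only n h² = (2/9) z².
  · refine le_benchmark_of_segment hBm hBp hn hz hh hcdf hfi (D := fun _ ↦ h)
      (memLp_const h) rfl ?_ fun lam _ ↦ ConvexOn.add_const hf _
    have hσ2 := sq_sigma hn j
    rw [hk] at hσ2
    simp at hσ2
    rw [setIntegral_const, Real.volume_real_Icc_of_le (by norm_num), h_def, mul_pow, mul_pow,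
      div_pow, h2, hk, zero_add, hσ2, smul_eq_mul]
    field_simp
    nlinarith [sq_nonneg z]
  · have hknot : k ∉ scaleSet P B n α f := Nat.notMem_of_lt_sInf (by
      change k < j
      lia)
    set u : ℝ := 2 ^ (-(k : ℤ)) with hu_def
    have hu := two_zpow_neg_mem_obsInterval hk0
    have hu0 : 0 < u := by positivity
    set d := (f u + f (-u)) / 2 - f 0
    have hh' : h = 2 / 3 * z * sigma n k := by
      rw [h_def, hk, sigma_succ]
      linear_combination (z * sigma n k / 3) * h2
    -- Scale k is rejected by minimality of j, so d ≥ E T_k > (2/3) z σ_k = h.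
    have hd : h < d := by
      rw [hh']
      refine (not_le.1 fun hle ↦ hknot ⟨hk0, hle⟩).trans_le (integral_tStat_le hBp n hf hk0)
    have hd0 : 0 < d := hh.trans hd
    refine le_benchmark_of_segment hBm hBp hn hz hh hcdf hfi
      (D := fun x ↦ h / d * max 0 (chord f u x - f x)) ?_ ?_ ?_ fun lam hlam ↦ ?_
    · exact (memLp_max_chord hf u).const_mul _
    · have : max 0 (chord f u 0 - f 0) = d := by
        rw [show chord f u 0 - f 0 = d by simp [chord, d]]
        exact max_eq_right hd0.le
      rw [this]
      field_simp
    · simp_rw [mul_pow]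
      rw [integral_const_mul]
      calc n * ((h / d) ^ 2 * ∫ x in obsInterval, max 0 (chord f u x - f x) ^ 2)
          ≤ n * ((h / d) ^ 2 * (4 * u * d ^ 2)) := by
            gcongr
            exact integral_sq_max_chord_le hf hu hu0
        -- The powers of two cancel: n · 4 · 2^{-k} · (4/9) z² · 2^{k-1}/n.
        _ = 8 / 9 * z ^ 2 := by
            have hσ2 := sq_sigma hn k
            rw [hh', div_pow, mul_pow, mul_pow, hσ2, hu_def, zpow_sub₀ two_ne_zero, zpow_neg]
            field_simp
            norm_num
        _ ≤ z ^ 2 := by linarith [sq_nonneg z]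
    · have hc : lam * (h / d) ∈ Icc (0 : ℝ) 1 :=
        ⟨mul_nonneg hlam.1 (by positivity),
          mul_le_one₀ hlam.2 (by positivity) ((div_le_one hd0).2 hd.le)⟩
      simpa only [mul_assoc] using add_mul_max_chord_mem_convexClass hf u hc
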